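/- A \emph{solution} (of the Yang--Baxter equation) is a pair $(X,r)$ with $X$ a non-empty set and $r\colon X\times X\to X\times X$, $r(x,y)=(\sigma_x(y),\gamma_y(x))$, such that $r^2=\mathrm{id}$, all maps $\sigma_x,\gamma_y\colon X\to X$ are bijective, and $r_{12}r_{23}r_{12}=r_{23}r_{12}r_{23}$ on $X^3$, where $r_{12}=r\times\mathrm{id}_X$ and $r_{23}=\mathrm{id}_X\times r$. A homomorphism $(X,r)\to(Y,s)$ of solutions, with $s(t,z)=(\sigma'_t(z),\gamma'_z(t))$, is a map $f$ with $f(\sigma_x(y))=\sigma'_{f(x)}(f(y))$ and $f(\gamma_y(x))=\gamma'_{f(y)}(f(x))$ for all $x,y\in X$; a solution $(X,r)$ is \emph{simple} if $|X|>1$ and every surjective homomorphism of solutions $(X,r)\to(Y,s)$ is an isomorphism or has $|Y|=1$. A \emph{left brace} is a set $B$ with an abelian group structure $+$ and a group structure $\circ$ such that $a\circ(b+c)+a=a\circ b+a\circ c$ for all $a,b,c\in B$; put $\lambda_a(b)=-a+a\circ b$. An ideal of $B$ is a normal subgroup of $(B,\circ)$ that is invariant under all $\lambda_a$, $a\in B$;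 $B$ is \emph{simple} if $B\neq\{0\}$ and $\{0\}$ and $B$ are its only ideals. The structure group $G(X,r)=\langle x\in X\mid xy=\sigma_x(y)\gamma_y(x),\ x,y\in X\rangle$ of a solution is a left brace in which $\lambda_x(y)=\sigma_x(y)$ for $x,y\in X$, and the permutation group $\mathcal G(X,r)=\langle\sigma_x\mid x\in X\rangle\le\mathrm{Sym}_X$ carries the unique left brace structure, with composition as multiplication, for which the group homomorphism $G(X,r)\to\mathcal G(X,r)$, $x\mapsto\sigma_x$, is a homomorphism of left braces. \textbf{Proposition.} Let $p=2k+1$ be a prime with $k$ odd. Let $A=\mathbb Z/(2p)$ and define $(j_a)_{a\in A}$ by $$j_i=-j_{p-i}=-j_{p+i}=j_{2p-i}=2i-1\in A\qquad(i=1,\dots,k),\qquad j_0=-j_p=-2\sum_{i=1}^k(-1)^i j_i .$$ Let $$r((a_1,a_2),(c_1,c_2))=\bigl(\sigma_{(a_1,a_2)}(c_1,c_2),\ \sigma^{-1}_{\sigma_{(a_1,a_2)}(c_1,c_2)}(a_1,a_2)\bigr),\qquad \sigma_{(a_1,a_2)}(c_1,c_2)=(c_1+a_2,\ c_2-j_{c_1+a_2-a_1}),$$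 for $a_1,a_2,c_1,c_2\in A$. Then $(A^2,r)$ is a solution, it is a simple solution of cardinality $|A^2|=4p^2$, and $\mathcal G(A^2,r)$ is a simple left brace. In particular there exist finite simple solutions $(X,r)$ for which $\mathcal G(X,r)$ is a simple left brace. -/

import Mathlib

universe u v

/-! ### Left braces -/

/-- A left brace: an abelian group `(B, +)` and a group `(B, *)` on the same set with
`a * (b + c) + a = a * b + a * c`. -/
class LeftBrace (B : Type u) extends AddCommGroup B, Group B where
  brace_identity : ∀ a b c : B, a * (b + c) + a = a * b + a * c

/-- The lambda map `lam a b = -a + a * b`. -/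
def LeftBrace.lam {B : Type u} [LeftBrace B] (a b : B) : B := -a + a * b

/-- An ideal of a left brace: a normal subgroup of the multiplicative group that is invariant
under all the lambda maps. -/
def LeftBrace.IsIdeal {B : Type u} [LeftBrace B] (I : Subgroup B) : Prop :=
  I.Normal ∧ ∀ a : B, ∀ b ∈ I, LeftBrace.lam a b ∈ I

/-- A simple left brace: non-zero, and the only ideals are zero and the whole brace. -/
def LeftBrace.IsSimple (B : Type u) [LeftBrace B] : Prop :=
  Nontrivial B ∧ ∀ I : Subgroup B, LeftBrace.IsIdeal I → I = ⊥ ∨ I = ⊤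

/-! ### Solutions of the Yang-Baxter equation -/

/-- `r × id` on `X³`. -/
def YBE.r12 {X : Type u} (r : X × X → X × X) (t : X × X × X) : X × X × X :=
  ((r (t.1, t.2.1)).1, (r (t.1, t.2.1)).2, t.2.2)

/-- `id × r` on `X³`. -/
def YBE.r23 {X : Type u} (r : X × X → X × X) (t : X × X × X) : X × X × X :=
  (t.1, r t.2)

/-- An involutive, non-degenerate, set-theoretic solution of the Yang-Baxter equation on `X`. -/
structure YBESolution (X : Type u) where
  r : X × X → X × X
  nonempty : Nonempty X
  involutive : ∀ t, r (r t) = t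
  bijective_left : ∀ x, Function.Bijective fun y => (r (x, y)).1
  bijective_right : ∀ y, Function.Bijective fun x => (r (x, y)).2
  yang_baxter : ∀ t, YBE.r12 r (YBE.r23 r (YBE.r12 r t)) = YBE.r23 r (YBE.r12 r (YBE.r23 r t))

namespace YBESolution

variable {X : Type u} {Y : Type v}

/-- `r (x, y) = (σ x y, γ y x)`. -/
noncomputable def σ (S : YBESolution X) (x : X) : Equiv.Perm X :=
  Equiv.ofBijective _ (S.bijective_left x)

/-- `r (x, y) = (σ x y, γ y x)`. -/
noncomputable def γ (S : YBESolution X) (y : X) : Equiv.Perm X :=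
  Equiv.ofBijective _ (S.bijective_right y)

theorem r_eq (S : YBESolution X) (x y : X) : S.r (x, y) = (S.σ x y, S.γ y x) := rfl

/-- Homomorphisms of solutions. -/
def IsHom (S : YBESolution X) (T : YBESolution Y) (f : X → Y) : Prop :=
  ∀ x y, f (S.σ x y) = T.σ (f x) (f y) ∧ f (S.γ y x) = T.γ (f y) (f x)

/-- A solution is simple if `|X| > 1` and every epimorphism (surjective homomorphism) of solutions
`f : (X, r) → (Y, s)` is an isomorphism (a bijective homomorphism) or has `|Y| = 1`.
As a surjective image of `X`, the set `Y` may be taken in the universe of `X`. -/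
def IsSimple (S : YBESolution X) : Prop :=
  Nontrivial X ∧ ∀ (Y : Type u) (T : YBESolution Y) (f : X → Y),
    S.IsHom T f → Function.Surjective f → Function.Bijective f ∨ Nat.card Y = 1

/-! ### The structure group and the permutation group -/

/-- The defining relations `x y = σ_x(y) γ_y(x)` of the structure group. -/
def relations (S : YBESolution X) : Set (FreeGroup X) :=
  {w | ∃ x y, w = FreeGroup.of x * FreeGroup.of y *
    (FreeGroup.of (S.σ x y) * FreeGroup.of (S.γ y x))⁻¹}

/-- The structure group `G(X, r)`. -/
abbrev StructureGroup (S : YBESolution X) : Type u := PresentedGroup S.relations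

/-- The permutation group of `(X, r)`, generated by the `σ x` in the symmetric group of `X`. -/
def permutationGroup (S : YBESolution X) : Subgroup (Equiv.Perm X) :=
  Subgroup.closure (Set.range S.σ)

/-- `σ x` as an element of the permutation group. -/
noncomputable def σ' (S : YBESolution X) (x : X) : S.permutationGroup :=
  ⟨S.σ x, Subgroup.subset_closure ⟨x, rfl⟩⟩

theorem σ_mul (S : YBESolution X) (x y : X) : S.σ x * S.σ y = S.σ (S.σ x y) * S.σ (S.γ y x) := by
  ext z
  have h := congrArg Prod.fst (S.yang_baxter (x, y, z))
  simp only [YBE.r12, YBE.r23, r_eq] at h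
  simpa using h.symm

theorem σ'_mul (S : YBESolution X) (x y : X) :
    S.σ' x * S.σ' y = S.σ' (S.σ x y) * S.σ' (S.γ y x) :=
  Subtype.ext (S.σ_mul x y)

/-- The canonical homomorphism `x ↦ σ x` from the structure group to the permutation group. -/
noncomputable def φ (S : YBESolution X) : S.StructureGroup →* S.permutationGroup :=
  PresentedGroup.toGroup (f := S.σ') (by
    rintro w ⟨x, y, rfl⟩
    simp only [map_mul, map_inv, FreeGroup.lift_apply_of, mul_inv_eq_one]
    exact S.σ'_mul x y)

theorem φ_of (S : YBESolution X) (x : X) : S.φ (PresentedGroup.of x) = S.σ' x :=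
  PresentedGroup.toGroup.of _

/-! ### The natural left brace structures

Let `G` be a group generated by elements `ι x`, `x ∈ X`, with `ι x * ι y = ι (σ x y) * ι (γ y x)`,
that acts on `X` by `ψ` with `ψ (ι x) = σ x`. The maps `g ↦ g * ι (ψ g⁻¹ x)` are commuting
permutations of `G`; they generate a regular abelian group of permutations of `G`, which is the
group of translations of the addition of `G`. This is used for the structure group and for the
permutation group. -/

/-- A group generated by a copy of `X` subject to (at least) the relations of the structure group,
with the action on `X` determined by `σ`. -/
structure Cover (S : YBESolution X) (G : Type v) [Group G] where
  ι : X → G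
  ψ : G →* Equiv.Perm X
  ψ_ι : ∀ x, ψ (ι x) = S.σ x
  rel : ∀ x y, ι x * ι y = ι (S.σ x y) * ι (S.γ y x)
  gen : Subgroup.closure (Set.range ι) = ⊤

theorem γ_diag (S : YBESolution X) (x : X) : S.γ ((S.σ x).symm x) x = (S.σ x).symm x := by
  have h := S.involutive (x, (S.σ x).symm x)
  rw [S.r_eq x, Equiv.apply_symm_apply, r_eq] at h
  have h1 := congrArg Prod.fst h
  exact (Equiv.eq_symm_apply _).2 h1

theorem σ_diag (S : YBESolution X) (z : X) : S.σ ((S.γ z).symm z) z = (S.γ z).symm z := by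
  have h := S.involutive ((S.γ z).symm z, z)
  rw [S.r_eq _ z, Equiv.apply_symm_apply, r_eq] at h
  have h1 := congrArg Prod.snd h
  exact (Equiv.eq_symm_apply _).2 h1

theorem γ_eq (S : YBESolution X) (x y : X) : S.γ y x = (S.σ (S.σ x y)).symm x := by
  have h := S.involutive (x, y)
  rw [S.r_eq x y, r_eq] at h
  exact (Equiv.eq_symm_apply _).2 (congrArg Prod.fst h)

namespace Cover

variable {S : YBESolution X} {G : Type v} [Group G] (C : S.Cover G)

theorem rel' (y w : X) :
    C.ι y * C.ι ((S.σ y).symm w) = C.ι w * C.ι ((S.σ w).symm y) := by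
  rw [C.rel, Equiv.apply_symm_apply, S.γ_eq, Equiv.apply_symm_apply]

/-- The translation `g ↦ g + ι x`, i.e. `g ↦ g * ι (ψ g⁻¹ x)`. -/
noncomputable def translation (x : X) : Equiv.Perm G where
  toFun g := g * C.ι ((C.ψ g).symm x)
  invFun h := h * (C.ι ((S.γ ((C.ψ h).symm x)).symm ((C.ψ h).symm x)))⁻¹
  left_inv g := by
    have h1 : (C.ψ (g * C.ι ((C.ψ g).symm x))).symm x
        = (S.σ ((C.ψ g).symm x)).symm ((C.ψ g).symm x) := by
      rw [map_mul, C.ψ_ι]; rfl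
    simp only [h1]
    have h2 := S.γ_diag ((C.ψ g).symm x)
    rw [← Equiv.eq_symm_apply] at h2
    rw [← h2]; simp
  right_inv h := by
    have h2 := S.σ_diag ((C.ψ h).symm x)
    have h1 : (C.ψ (h * (C.ι ((S.γ ((C.ψ h).symm x)).symm ((C.ψ h).symm x)))⁻¹)).symm x
        = (S.γ ((C.ψ h).symm x)).symm ((C.ψ h).symm x) := by
      rw [map_mul, map_inv, C.ψ_ι]; exact h2
    simp only [h1]; simp

theorem translation_apply (x : X) (g : G) :
    C.translation x g = g * C.ι ((C.ψ g).symm x) := rfl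

theorem translation_comm (x y : X) :
    C.translation x * C.translation y = C.translation y * C.translation x := by
  ext g
  simp only [Equiv.Perm.mul_apply, translation_apply, map_mul, C.ψ_ι, mul_assoc]
  exact congrArg (g * ·) (C.rel' _ _)

/-- The group of all translations. -/
def translations : Subgroup (Equiv.Perm G) := Subgroup.closure (Set.range C.translation)

theorem translations_comm {s t : Equiv.Perm G} (hs : s ∈ C.translations)
    (ht : t ∈ C.translations) : s * t = t * s := by
  have h : ∀ x ∈ Set.range C.translation, ∀ y ∈ Set.range C.translation, x * y = y * x := by
    rintro _ ⟨x, rfl⟩ _ ⟨y, rfl⟩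
    exact C.translation_comm x y
  have := Subgroup.isMulCommutative_closure h
  exact congrArg Subtype.val (this.is_comm.comm ⟨s, hs⟩ ⟨t, ht⟩)

theorem exists_translation (g : G) : ∃ t ∈ C.translations, t 1 = g := by
  have hg : g ∈ Subgroup.closure (Set.range C.ι) := by rw [C.gen]; trivial
  induction hg using Subgroup.closure_induction_right with
  | one => exact ⟨1, one_mem _, rfl⟩
  | mul_right g hg y hy ih =>
    obtain ⟨x, rfl⟩ := hy
    obtain ⟨t, ht, rfl⟩ := ih
    refine ⟨C.translation (C.ψ (t 1) x) * t,
      mul_mem (Subgroup.subset_closure ⟨_, rfl⟩) ht, ?_⟩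
    simp [translation_apply]
  | mul_inv_cancel g hg y hy ih =>
    obtain ⟨x, rfl⟩ := hy
    obtain ⟨t, ht, rfl⟩ := ih
    refine ⟨(C.translation (C.ψ (t 1) ((S.σ x).symm x)))⁻¹ * t,
      mul_mem (inv_mem (Subgroup.subset_closure ⟨_, rfl⟩)) ht, ?_⟩
    rw [Equiv.Perm.mul_apply, Equiv.Perm.inv_eq_iff_eq, translation_apply, map_mul, map_inv, C.ψ_ι]
    have : (C.ψ (t 1) * (S.σ x)⁻¹).symm (C.ψ (t 1) ((S.σ x).symm x)) = x := by
      rw [Equiv.symm_apply_eq]; rfl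
    rw [this, inv_mul_cancel_right]

/-- The unique translation that maps `1` to `g`. -/
noncomputable def trans (g : G) : Equiv.Perm G := (C.exists_translation g).choose

theorem trans_mem (g : G) : C.trans g ∈ C.translations := (C.exists_translation g).choose_spec.1

theorem trans_one (g : G) : C.trans g 1 = g := (C.exists_translation g).choose_spec.2

theorem translations_ext {s t : Equiv.Perm G} (hs : s ∈ C.translations)
    (ht : t ∈ C.translations) (g : G) (h : s g = t g) : s = t := by
  have key : ∀ a, ∃ u ∈ C.translations, a = u g := fun a =>
    ⟨C.trans a * (C.trans g)⁻¹, mul_mem (C.trans_mem _) (inv_mem (C.trans_mem _)), by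
      have : (C.trans g)⁻¹ g = 1 := by rw [Equiv.Perm.inv_eq_iff_eq, C.trans_one]
      rw [Equiv.Perm.mul_apply, this, C.trans_one]⟩
  ext a
  obtain ⟨u, hu, rfl⟩ := key a
  rw [← Equiv.Perm.mul_apply, ← Equiv.Perm.mul_apply, C.translations_comm hs hu,
    C.translations_comm ht hu, Equiv.Perm.mul_apply, Equiv.Perm.mul_apply, h]

theorem trans_eq {t : Equiv.Perm G} (ht : t ∈ C.translations) : C.trans (t 1) = t :=
  C.translations_ext (C.trans_mem _) ht 1 (C.trans_one _)

theorem trans_trans (g h : G) : C.trans (C.trans g h) = C.trans g * C.trans h := by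
  have := C.trans_eq (mul_mem (C.trans_mem g) (C.trans_mem h))
  rwa [Equiv.Perm.mul_apply, C.trans_one] at this

theorem conj_mem (a : G) {t : Equiv.Perm G} (ht : t ∈ C.translations) :
    Equiv.mulLeft a * t * (Equiv.mulLeft a)⁻¹ ∈ C.translations := by
  induction ht using Subgroup.closure_induction with
  | mem t ht =>
    obtain ⟨x, rfl⟩ := ht
    refine Subgroup.subset_closure ⟨C.ψ a x, ?_⟩
    ext g
    have h : (C.ψ (a⁻¹ * g)).symm x = (C.ψ g).symm (C.ψ a x) := by
      rw [Equiv.symm_apply_eq, map_mul, map_inv]; simp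
    change g * C.ι ((C.ψ g).symm (C.ψ a x))
      = a * (a⁻¹ * g * C.ι ((C.ψ (a⁻¹ * g)).symm x))
    rw [h, mul_assoc, mul_inv_cancel_left]
  | one => rw [mul_one, mul_inv_cancel]; exact one_mem _
  | mul s t _ _ hs ht =>
    have := mul_mem hs ht
    rwa [conj_mul] at this
  | inv t _ ht =>
    have := inv_mem ht
    rwa [conj_inv] at this

/-- The addition whose translation group is `C.translations`, with zero element `1`. -/
@[reducible] noncomputable def addCommGroup : AddCommGroup G :=
  letI : Add G := ⟨fun g h => C.trans g h⟩
  letI : Zero G := ⟨1⟩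
  letI : Neg G := ⟨fun g => (C.trans g)⁻¹ 1⟩
  have comm : ∀ g h : G, g + h = h + g := fun g h => by
    change C.trans g h = C.trans h g
    conv_lhs => rw [← C.trans_one h, ← Equiv.Perm.mul_apply,
      C.translations_comm (C.trans_mem g) (C.trans_mem h), Equiv.Perm.mul_apply, C.trans_one]
  letI : AddGroup G := AddGroup.ofLeftAxioms
    (fun a b c => by
      change C.trans (C.trans a b) c = C.trans a (C.trans b c)
      rw [C.trans_trans]; rfl)
    (fun a => by
      rw [comm]; exact C.trans_one a)
    (fun a => by
      rw [comm]
      change C.trans a ((C.trans a)⁻¹ 1) = 1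
      simp)
  { add_comm := comm }

/-- The natural left brace structure on `G`; its multiplication is the one of `G`. -/
@[reducible] noncomputable def brace : LeftBrace G :=
  { toAddCommGroup := C.addCommGroup
    toGroup := inferInstance
    brace_identity := fun a b c => by
      change C.trans (a * C.trans b c) a = C.trans (a * b) (a * c)
      have hm := C.conj_mem a (C.trans_mem b)
      obtain ⟨t, ht⟩ : ∃ t, t = Equiv.mulLeft a * C.trans b * (Equiv.mulLeft a)⁻¹ := ⟨_, rfl⟩
      rw [← ht] at hm
      have h1 : t a = a * b := by simp [ht, C.trans_one]
      have h2 : a * C.trans b c = t (a * c) := by simp [ht]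
      have h3 : C.trans (a * b) = t * C.trans a := by
        rw [← C.trans_eq (mul_mem hm (C.trans_mem a)), Equiv.Perm.mul_apply, C.trans_one, h1]
      have h4 : C.trans (t (a * c)) = t * C.trans (a * c) := by
        rw [← C.trans_eq (mul_mem hm (C.trans_mem (a * c))), Equiv.Perm.mul_apply, C.trans_one]
      have h5 : C.trans (a * c) a = C.trans a (a * c) := by
        have := congrArg (fun u : Equiv.Perm G => u 1)
          (C.translations_comm (C.trans_mem (a * c)) (C.trans_mem a))
        simpa [C.trans_one] using this
      rw [h2, h4, h3, Equiv.Perm.mul_apply, Equiv.Perm.mul_apply, h5] }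

theorem add_def (g h : G) : letI := C.brace; g + h = C.trans g h := rfl

theorem add_ι (g : G) (x : X) : letI := C.brace; g + C.ι (C.ψ g x) = g * C.ι x := by
  let _ := C.brace
  have h : C.ι (C.ψ g x) = C.translation (C.ψ g x) 1 := by
    rw [translation_apply, one_mul, map_one]; rfl
  rw [C.add_def, h, ← Equiv.Perm.mul_apply, C.translations_comm (C.trans_mem g)
    (Subgroup.subset_closure ⟨_, rfl⟩), Equiv.Perm.mul_apply, C.trans_one, translation_apply]
  simp

theorem lam_ι (g : G) (x : X) : letI := C.brace; LeftBrace.lam g (C.ι x) = C.ι (C.ψ g x) := by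
  let _ := C.brace
  rw [LeftBrace.lam, ← C.add_ι, neg_add_cancel_left]

end Cover

/-- The structure group with its generators. -/
noncomputable def structureCover (S : YBESolution X) : S.Cover S.StructureGroup where
  ι := PresentedGroup.of
  ψ := S.permutationGroup.subtype.comp S.φ
  ψ_ι x := by rw [MonoidHom.comp_apply, φ_of]; rfl
  rel x y := by
    have h := PresentedGroup.one_of_mem (rels := S.relations) ⟨x, y, rfl⟩
    rw [map_mul, map_inv, mul_inv_eq_one, map_mul, map_mul] at h
    exact h
  gen := PresentedGroup.closure_range_of _

/-- The permutation group with its generators `σ x`. -/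
noncomputable def permutationCover (S : YBESolution X) : S.Cover S.permutationGroup where
  ι := S.σ'
  ψ := S.permutationGroup.subtype
  ψ_ι _ := rfl
  rel := S.σ'_mul
  gen := by
    rw [eq_top_iff, ← Subgroup.map_subtype_le_map_subtype, MonoidHom.map_closure,
      ← Set.range_comp]
    rintro _ ⟨⟨g, hg⟩, -, rfl⟩
    exact hg

/-- The natural left brace structure on the structure group. -/
noncomputable instance structureBrace (S : YBESolution X) : LeftBrace S.StructureGroup :=
  S.structureCover.brace

/-- The natural left brace structure on the permutation group. -/
noncomputable instance permutationBrace (S : YBESolution X) : LeftBrace S.permutationGroup :=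
  S.permutationCover.brace

/-- In the structure group, `λ_x(y) = σ_x(y)`. -/
theorem lam_of (S : YBESolution X) (x y : X) :
    LeftBrace.lam (PresentedGroup.of x : S.StructureGroup) (PresentedGroup.of y)
      = PresentedGroup.of (S.σ x y) := by
  have h := S.structureCover.lam_ι (PresentedGroup.of x) y
  have h' : S.structureCover.ψ (PresentedGroup.of x) = S.σ x := S.structureCover.ψ_ι x
  rw [h'] at h
  exact h

/-- In the permutation group, `λ_g(σ_y) = σ_{g(y)}`. -/
theorem lam_σ' (S : YBESolution X) (g : S.permutationGroup) (y : X) :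
    LeftBrace.lam g (S.σ' y) = S.σ' ((g : Equiv.Perm X) y) :=
  S.permutationCover.lam_ι g y

/-- The map `φ : G(X, r) → 𝒢(X, r)` is additive, hence a homomorphism of left braces. As it is
surjective, this determines the left brace structure of the permutation group. -/
theorem φ_add (S : YBESolution X) (g h : S.StructureGroup) : S.φ (g + h) = S.φ g + S.φ h := by
  have key : ∀ t ∈ S.structureCover.translations, ∃ t' ∈ S.permutationCover.translations,
      ∀ a, S.φ (t a) = t' (S.φ a) := by
    intro t ht
    induction ht using Subgroup.closure_induction with
    | mem t ht =>
      obtain ⟨x, rfl⟩ := ht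
      refine ⟨S.permutationCover.translation x, Subgroup.subset_closure ⟨x, rfl⟩, fun a => ?_⟩
      rw [Cover.translation_apply, Cover.translation_apply, map_mul]
      exact congrArg (S.φ a * ·) (S.φ_of _)
    | one => exact ⟨1, one_mem _, fun _ => rfl⟩
    | mul s t _ _ hs ht =>
      obtain ⟨s', hs', hs⟩ := hs
      obtain ⟨t', ht', ht⟩ := ht
      exact ⟨s' * t', mul_mem hs' ht', fun a => by simp [hs, ht]⟩
    | inv t _ ht =>
      obtain ⟨t', ht', ht⟩ := ht
      refine ⟨t'⁻¹, inv_mem ht', fun a => ?_⟩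
      rw [eq_comm, Equiv.Perm.inv_eq_iff_eq, ← ht]
      simp
  obtain ⟨t', ht', hh⟩ := key _ (S.structureCover.trans_mem g)
  have h1 : t' = S.permutationCover.trans (S.φ g) := by
    have := hh 1
    rw [Cover.trans_one, map_one] at this
    rw [this, Cover.trans_eq _ ht']
  change S.φ (S.structureCover.trans g h) = S.permutationCover.trans (S.φ g) (S.φ h)
  rw [hh, h1]

theorem φ_surjective (S : YBESolution X) : Function.Surjective S.φ := by
  rw [← MonoidHom.range_eq_top, eq_top_iff, ← S.permutationCover.gen, Subgroup.closure_le]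
  rintro _ ⟨x, rfl⟩
  exact ⟨PresentedGroup.of x, S.φ_of x⟩

end YBESolution

/-! ### The solutions on `A²` -/

/-- `σ_{(a₁,a₂)}(c₁,c₂) = (c₁ + a₂, c₂ - j_{c₁+a₂-a₁})`. -/
def squareSigma {A : Type u} [AddCommGroup A] (j : A → A) (a : A × A) : Equiv.Perm (A × A) where
  toFun c := (c.1 + a.2, c.2 - j (c.1 + a.2 - a.1))
  invFun c := (c.1 - a.2, c.2 + j (c.1 - a.1))
  left_inv c := by simp
  right_inv c := by simp

theorem squareSigma_apply {A : Type u} [AddCommGroup A] (j : A → A) (a c : A × A) :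
    squareSigma j a c = (c.1 + a.2, c.2 - j (c.1 + a.2 - a.1)) := rfl

theorem squareSigma_symm_apply {A : Type u} [AddCommGroup A] (j : A → A) (hj : ∀ a, j (-a) = j a)
    (a c : A × A) : (squareSigma j (squareSigma j a c)).symm a
      = (a.1 - c.2 + j (c.1 + a.2 - a.1), a.2 + j (c.1 + a.2 - a.1)) := by
  change (a.1 - (c.2 - j (c.1 + a.2 - a.1)), a.2 + j (a.1 - (c.1 + a.2))) = _
  have h : a.1 - (c.1 + a.2) = -(c.1 + a.2 - a.1) := by abel
  rw [h, hj]
  congr 1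
  abel

/-- The solution `(A², r)`, `r(a, c) = (σ_a(c), σ_{σ_a(c)}⁻¹(a))`, for a family `j` with
`j_{-a} = j_a`. -/
def squareSolution {A : Type u} [AddCommGroup A] (j : A → A) (hj : ∀ a, j (-a) = j a) :
    YBESolution (A × A) where
  r t := (squareSigma j t.1 t.2, (squareSigma j (squareSigma j t.1 t.2)).symm t.1)
  nonempty := ⟨0⟩
  involutive t := by simp
  bijective_left a := (squareSigma j a).bijective
  bijective_right c := by
    have h : (fun a => ((squareSigma j (squareSigma j a c)).symm a))
        = fun a => (a.1 - c.2 + j (c.1 + a.2 - a.1), a.2 + j (c.1 + a.2 - a.1)) := by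
      funext a
      rw [squareSigma_symm_apply j hj]
    change Function.Bijective fun a => (squareSigma j (squareSigma j a c)).symm a
    rw [h]
    refine Function.bijective_iff_has_inverse.2 ⟨fun u =>
      (u.1 + c.2 - j (u.2 - u.1 - c.2 + c.1), u.2 - j (u.2 - u.1 - c.2 + c.1)), fun a => ?_,
      fun u => ?_⟩
    · have e : a.2 + j (c.1 + a.2 - a.1) - (a.1 - c.2 + j (c.1 + a.2 - a.1)) - c.2 + c.1
          = c.1 + a.2 - a.1 := by abel
      simp only [e]
      ext <;> simp <;> abel
    · have e : c.1 + (u.2 - j (u.2 - u.1 - c.2 + c.1)) - (u.1 + c.2 - j (u.2 - u.1 - c.2 + c.1))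
          = u.2 - u.1 - c.2 + c.1 := by abel
      simp only [e]
      ext <;> simp <;> abel
  yang_baxter := by
    rintro ⟨⟨a₁, a₂⟩, ⟨c₁, c₂⟩, ⟨e₁, e₂⟩⟩
    simp only [YBE.r12, YBE.r23, squareSigma_symm_apply j hj]
    simp only [squareSigma_apply]
    have h1 : e₁ + (a₂ + j (c₁ + a₂ - a₁)) - (a₁ - c₂ + j (c₁ + a₂ - a₁))
        = e₁ + c₂ + a₂ - a₁ := by abel
    have h2 : e₁ + (a₂ + j (c₁ + a₂ - a₁)) + (c₂ - j (c₁ + a₂ - a₁)) - (c₁ + a₂)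
        = e₁ + c₂ - c₁ := by abel
    have h3 : c₁ - e₂ + j (e₁ + c₂ - c₁) + (a₂ + j (e₁ + c₂ + a₂ - a₁))
        - (a₁ - (e₂ - j (e₁ + c₂ - c₁)) + j (e₁ + c₂ + a₂ - a₁)) = c₁ + a₂ - a₁ := by abel
    simp only [h1, h2, h3]
    ext <;> dsimp only <;> abel

/-! ### The family `j` -/

/-- The value `j_0 = -2 ∑_{i=1}^k (-1)^i j_i`, where `j_i = 2 i - 1` for `1 ≤ i ≤ k`. -/
def jZero (p k : ℕ) : ZMod (2 * p) :=
  -2 * ∑ i ∈ Finset.Icc 1 k, (-1) ^ i * (2 * (i : ZMod (2 * p)) - 1)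

/-- For `p = 2 k + 1`, the family `(j_a)` indexed by `ZMod (2 p)`: the residues `0, …, 2 p - 1` are
`0`, `i`, `p - i`, `p`, `p + i`, `2 p - i` with `1 ≤ i ≤ k`. -/
def jFamily (p k : ℕ) (a : ZMod (2 * p)) : ZMod (2 * p) :=
  let n := a.val
  if n = 0 then jZero p k
  else if n ≤ k then 2 * (n : ZMod (2 * p)) - 1
  else if n < p then -(2 * ((p - n : ℕ) : ZMod (2 * p)) - 1)
  else if n = p then -jZero p k
  else if n ≤ p + k then -(2 * ((n - p : ℕ) : ZMod (2 * p)) - 1)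
  else 2 * ((2 * p - n : ℕ) : ZMod (2 * p)) - 1

theorem jFamily_neg {p k : ℕ} (h : p = 2 * k + 1) (a : ZMod (2 * p)) :
    jFamily p k (-a) = jFamily p k a := by
  have : NeZero (2 * p) := ⟨by omega⟩
  have hlt := a.val_lt
  by_cases ha : a = 0
  · rw [ha, neg_zero]
  have hn : a.val ≠ 0 := by rwa [Ne, ZMod.val_eq_zero]
  have hv : (-a).val = 2 * p - a.val := by rw [ZMod.neg_val, if_neg ha]
  unfold jFamily
  simp only [hv]
  rcases lt_trichotomy a.val p with hp | hp | hp
  · by_cases hk : a.val ≤ k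
    · have e : 2 * p - (2 * p - a.val) = a.val := by omega
      rw [if_neg (by omega), if_neg (by omega), if_neg (by omega), if_neg (by omega),
        if_neg (by omega), if_neg hn, if_pos hk, e]
    · have e : 2 * p - a.val - p = p - a.val := by omega
      rw [if_neg (by omega), if_neg (by omega), if_neg (by omega), if_neg (by omega),
        if_pos (by omega), if_neg hn, if_neg hk, if_pos hp, e]
  · have e : 2 * p - a.val = a.val := by omega
    simp only [e]
  · by_cases hk : a.val ≤ p + k
    · have e : p - (2 * p - a.val) = a.val - p := by omega
      rw [if_neg (by omega), if_neg (by omega), if_pos (by omega), if_neg hn,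
        if_neg (by omega), if_neg (by omega), if_neg (by omega), if_pos hk, e]
    · rw [if_neg (by omega), if_pos (by omega), if_neg hn, if_neg (by omega), if_neg (by omega),
        if_neg (by omega), if_neg hk]

/-- `j_i = -j_{p-i} = -j_{p+i} = j_{2p-i} = 2i - 1` for `1 ≤ i ≤ k`. -/
theorem jFamily_spec {p k : ℕ} (h : p = 2 * k + 1) (i : ℕ) (hi : 1 ≤ i) (hik : i ≤ k) :
    jFamily p k (i : ZMod (2 * p)) = 2 * (i : ZMod (2 * p)) - 1 ∧
    -jFamily p k ((p - i : ℕ) : ZMod (2 * p)) = 2 * (i : ZMod (2 * p)) - 1 ∧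
    -jFamily p k ((p + i : ℕ) : ZMod (2 * p)) = 2 * (i : ZMod (2 * p)) - 1 ∧
    jFamily p k ((2 * p - i : ℕ) : ZMod (2 * p)) = 2 * (i : ZMod (2 * p)) - 1 := by
  have : NeZero (2 * p) := ⟨by omega⟩
  have e1 : p - (p - i) = i := by omega
  have e2 : p + i - p = i := by omega
  have e3 : 2 * p - (2 * p - i) = i := by omega
  refine ⟨?_, ?_, ?_, ?_⟩
  · simp only [jFamily, ZMod.val_natCast_of_lt (show i < 2 * p by omega)]
    rw [if_neg (by omega), if_pos hik]
  · simp only [jFamily, ZMod.val_natCast_of_lt (show p - i < 2 * p by omega)]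
    rw [if_neg (by omega), if_neg (by omega), if_pos (by omega), e1, neg_neg]
  · simp only [jFamily, ZMod.val_natCast_of_lt (show p + i < 2 * p by omega)]
    rw [if_neg (by omega), if_neg (by omega), if_neg (by omega), if_neg (by omega),
      if_pos (by omega), e2, neg_neg]
  · simp only [jFamily, ZMod.val_natCast_of_lt (show 2 * p - i < 2 * p by omega)]
    rw [if_neg (by omega), if_neg (by omega), if_neg (by omega), if_neg (by omega),
      if_neg (by omega), e3]

/-- `j_0 = -j_p = -2 ∑_{i=1}^k (-1)^i j_i`. -/
theorem jFamily_zero {p k : ℕ} (h : p = 2 * k + 1) :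
    jFamily p k 0 = -2 * ∑ i ∈ Finset.Icc 1 k, (-1) ^ i * jFamily p k (i : ZMod (2 * p)) ∧
    -jFamily p k (p : ZMod (2 * p)) = jFamily p k 0 := by
  have : NeZero (2 * p) := ⟨by omega⟩
  have h0 : jFamily p k 0 = jZero p k := by simp [jFamily]
  refine ⟨?_, ?_⟩
  · rw [h0, jZero]
    congr 1
    refine Finset.sum_congr rfl fun i hi => ?_
    rw [Finset.mem_Icc] at hi
    rw [(jFamily_spec h i hi.1 hi.2).1]
  · rw [h0]
    simp only [jFamily, ZMod.val_natCast_of_lt (show p < 2 * p by omega)]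
    rw [if_neg (by omega), if_neg (by omega), if_neg (by omega), if_pos trivial, neg_neg]

/-- The solution `(A², r)`, `A = ZMod (2 p)`, of the family `j`. -/
def exampleSolution {p k : ℕ} (h : p = 2 * k + 1) : YBESolution (ZMod (2 * p) × ZMod (2 * p)) :=
  squareSolution (jFamily p k) (jFamily_neg h)

/-! ### The family `j` -/

section JFamily

variable {p k : ℕ}

/-! The argument rests on four properties of `j`: it is even, `j (a + p) = -j a`, `j 1 = 1`, and `j
a` is an even residue exactly when `p` divides `a`. Since multiplication by `p` on `ZMod (2 * p)`
sees only parity, parity separates the multiples of `p` from the other arguments.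

Both simplicity claims follow one pattern. A nontrivial congruence, or a nonzero ideal, produces a
nonzero subgroup of `ZMod (2 * p)`: the vertical periods of the quotient map, or the horizontal
translations in the ideal. Such a subgroup contains `p` or `2` because `p` is prime. If it contains
`p`, antiperiodicity puts `4` in it, and `p` and `4` are coprime; if it contains `2`, the odd
element `j 0 - j 2` or its negative completes it (`addSubgroup_eq_top`). So the subgroup is
everything.

For a congruence, full vertical periods identify all points (`injective_or_forall_eq`). For an
ideal, all horizontal translations lie in it, and their commutators with the generators combine to
give the vertical shears by the translates of `j`, hence all generators
(`jFamily_mem_verticalShears`). -/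

theorem jFamily_one (h : p = 2 * k + 1) (hk : 1 ≤ k) : jFamily p k 1 = 1 := by
  have := (jFamily_spec h 1 le_rfl hk).1
  rw [Nat.cast_one] at this
  rw [this]
  ring

theorem natCast_two_mul_self (p : ℕ) : (p : ZMod (2 * p)) + p = 0 := by
  have := ZMod.natCast_self (2 * p)
  rw [← this]
  push_cast
  ring

theorem jFamily_natCast_add (h : p = 2 * k + 1) (n : ℕ) (hn : n < p) :
    jFamily p k ((n : ZMod (2 * p)) + p) = -jFamily p k n := by
  rcases Nat.eq_zero_or_pos n with rfl | h0
  · rw [Nat.cast_zero, zero_add, ← (jFamily_zero h).2, neg_neg]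
  by_cases hnk : n ≤ k
  · have := jFamily_spec h n h0 hnk
    have e : (n : ZMod (2 * p)) + p = ((p + n : ℕ) : ZMod (2 * p)) := by push_cast; ring
    rw [e, this.1, ← this.2.2.1, neg_neg]
  · obtain ⟨i, hi, hik, rfl⟩ : ∃ i, 1 ≤ i ∧ i ≤ k ∧ n = p - i :=
      ⟨p - n, by omega, by omega, by omega⟩
    have := jFamily_spec h i hi hik
    have e : ((p - i : ℕ) : ZMod (2 * p)) + p = ((2 * p - i : ℕ) : ZMod (2 * p)) := by
      rw [← Nat.cast_add]
      congr 1
      omega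
    rw [e, this.2.2.2, this.2.1]

/-- The family `j` is `p`-antiperiodic. -/
theorem jFamily_add_self (h : p = 2 * k + 1) (a : ZMod (2 * p)) :
    jFamily p k (a + p) = -jFamily p k a := by
  have : NeZero (2 * p) := ⟨by omega⟩
  have hlt := a.val_lt
  by_cases hn : a.val < p
  · have := jFamily_natCast_add h a.val hn
    rwa [ZMod.natCast_zmod_val] at this
  -- The representative `a.val - p` is that of `a + p`, because `2p = 0`.
  · have key := jFamily_natCast_add h (a.val - p) (by omega)
    have e : ((a.val - p : ℕ) : ZMod (2 * p)) = a + p := by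
      rw [Nat.cast_sub (by omega), ZMod.natCast_zmod_val, sub_eq_iff_eq_add, add_assoc,
        natCast_two_mul_self, add_zero]
    rw [e, add_assoc, natCast_two_mul_self, add_zero] at key
    rw [key, neg_neg]

/-- Reduction modulo `2`. -/
abbrev parity (p : ℕ) : ZMod (2 * p) →+* ZMod 2 := ZMod.castHom (dvd_mul_right 2 p) (ZMod 2)

/-- Reduction modulo `p`. -/
abbrev residue (p : ℕ) : ZMod (2 * p) →+* ZMod p := ZMod.castHom (dvd_mul_left p 2) (ZMod p)

theorem residue_eq_zero_iff (h : p = 2 * k + 1) (a : ZMod (2 * p)) :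
    residue p a = 0 ↔ a = 0 ∨ a = p := by
  have : NeZero (2 * p) := ⟨by omega⟩
  constructor
  · intro ha
    have hlt := a.val_lt
    rw [← ZMod.natCast_zmod_val a, map_natCast, ZMod.natCast_eq_zero_iff] at ha
    obtain ⟨m, hm⟩ := ha
    rw [← ZMod.natCast_zmod_val a, hm]
    have : m < 2 := by
      rw [hm, mul_comm] at hlt
      exact lt_of_mul_lt_mul_right hlt (Nat.zero_le _)
    interval_cases m <;> simp
  · rintro (rfl | rfl) <;> simp

/-- `j_a` is even if and only if `a` is `0` or `p`. -/
theorem parity_jFamily (h : p = 2 * k + 1) (a : ZMod (2 * p)) :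
    parity p (jFamily p k a) = if residue p a = 0 then 0 else 1 := by
  have : NeZero (2 * p) := ⟨by omega⟩
  have two : (2 : ZMod 2) = 0 := rfl
  have hz : parity p (jZero p k) = 0 := by
    rw [jZero, map_mul, map_neg, map_ofNat, two, neg_zero, zero_mul]
  have hlt := a.val_lt
  split_ifs with hr
  · rcases (residue_eq_zero_iff h a).1 hr with rfl | rfl
    · simpa [jFamily] using hz
    · rw [← neg_eq_zero, ← map_neg, (jFamily_zero h).2]
      simpa [jFamily] using hz
  · rw [residue_eq_zero_iff h, not_or] at hr
    have h0 : a.val ≠ 0 := by rw [Ne, ZMod.val_eq_zero]; exact hr.1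
    have h1 : a.val ≠ p := fun e => hr.2 (by rw [← ZMod.natCast_zmod_val a, e])
    have key : ∀ z : ZMod (2 * p), parity p (2 * z - 1) = 1 := fun z => by
      rw [map_sub, map_mul, map_ofNat, two, zero_mul, map_one]; rfl
    have key' : ∀ z : ZMod (2 * p), parity p (-(2 * z - 1)) = 1 := fun z => by
      rw [map_neg, key]; rfl
    simp only [jFamily, h0, h1, if_false]
    split_ifs <;> simp only [key, key']

/-- The sum of `j` over `p` consecutive arguments is even. -/
theorem parity_sum_jFamily (h : p = 2 * k + 1) (u : ZMod (2 * p)) :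
    parity p (∑ n ∈ Finset.range p, jFamily p k (u - n)) = 0 := by
  have : NeZero p := ⟨by omega⟩
  -- Exactly one of `p` consecutive arguments is a multiple of `p`, so the sum is congruent to `p -
  -- 1 = 2k` modulo `2`.
  have e : ∀ n ∈ Finset.range p, parity p (jFamily p k (u - n))
      = 1 - if (residue p u).val = n then 1 else 0 := by
    intro n hn
    have hiff : residue p (u - n) = 0 ↔ (residue p u).val = n := by
      rw [map_sub, map_natCast, sub_eq_zero]
      constructor
      · intro hu
        rw [hu, ZMod.val_natCast_of_lt (Finset.mem_range.1 hn)]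
      · intro hu
        rw [← hu, ZMod.natCast_zmod_val]
    rw [parity_jFamily h]
    simp only [hiff]
    split_ifs <;> simp
  rw [map_sum, Finset.sum_congr rfl e, Finset.sum_sub_distrib, Finset.sum_ite_eq,
    if_pos (Finset.mem_range.2 (ZMod.val_lt _)), Finset.sum_const, Finset.card_range, nsmul_one, h]
  push_cast
  have two : (2 : ZMod 2) = 0 := rfl
  rw [two]
  ring

theorem natCast_mul_eq_zero (z : ZMod (2 * p)) (hz : parity p z = 0) (h : p ≠ 0) :
    (p : ZMod (2 * p)) * z = 0 := by
  have : NeZero (2 * p) := ⟨by omega⟩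
  rw [← ZMod.natCast_zmod_val z, map_natCast, ZMod.natCast_eq_zero_iff] at hz
  rw [mul_comm (p : ZMod (2 * p)), ← ZMod.natCast_zmod_val z, ← Nat.cast_mul,
    ZMod.natCast_eq_zero_iff]
  exact mul_dvd_mul_right hz p

theorem natCast_mul_ne_zero (z : ZMod (2 * p)) (hz : parity p z ≠ 0) (h : p ≠ 0) :
    (p : ZMod (2 * p)) * z ≠ 0 := by
  have : NeZero (2 * p) := ⟨by omega⟩
  rw [Ne, ← ZMod.natCast_zmod_val z, map_natCast, ZMod.natCast_eq_zero_iff] at hz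
  rw [mul_comm (p : ZMod (2 * p)), ← ZMod.natCast_zmod_val z, ← Nat.cast_mul, Ne,
    ZMod.natCast_eq_zero_iff]
  exact fun hd => hz (Nat.dvd_of_mul_dvd_mul_right (Nat.pos_of_ne_zero h) hd)

theorem two_ne_zero_zmod (h : p = 2 * k + 1) (hk : 1 ≤ k) : (2 : ZMod (2 * p)) ≠ 0 := by
  intro e
  have e' : ((2 : ℕ) : ZMod (2 * p)) = 0 := e
  rw [ZMod.natCast_eq_zero_iff] at e'
  have := Nat.le_of_dvd (by omega) e'
  omega

/-! ### Subgroups of `ZMod (2 * p)` -/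

theorem addSubgroup_eq_top_of_one_mem {n : ℕ} {P : AddSubgroup (ZMod n)} (h1 : 1 ∈ P) :
    P = ⊤ := by
  rw [eq_top_iff]
  rintro z -
  obtain ⟨m, rfl⟩ := ZMod.intCast_surjective z
  simpa using P.zsmul_mem h1 m

/-- Subgroups of `ZMod (2 * p)` correspond to divisors of `2p`; a proper divisor is `1`, `2` or `p`.
-/
theorem exists_mem_of_ne_bot (hp : p.Prime) {P : AddSubgroup (ZMod (2 * p))} (hP : P ≠ ⊥) :
    (p : ZMod (2 * p)) ∈ P ∨ (2 : ZMod (2 * p)) ∈ P := by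
  have : NeZero (2 * p) := ⟨by have := hp.pos; omega⟩
  obtain ⟨t, ht, ht0⟩ := P.bot_or_exists_ne_zero.resolve_left hP
  have hpos : 0 < t.val := Nat.pos_of_ne_zero (by rwa [Ne, ZMod.val_eq_zero])
  have hlt := t.val_lt
  -- By Bézout the gcd is an integer multiple of `t`, as `2p` vanishes.
  have hg : ((Nat.gcd t.val (2 * p) : ℕ) : ZMod (2 * p)) ∈ P := by
    have e := congrArg (Int.cast : ℤ → ZMod (2 * p)) (Nat.gcd_eq_gcd_ab t.val (2 * p))
    push_cast at e
    have z := ZMod.natCast_self (2 * p)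
    push_cast at z
    rw [ZMod.natCast_zmod_val, z, zero_mul, add_zero, mul_comm t, ← zsmul_eq_mul] at e
    rw [e]
    exact P.zsmul_mem ht _
  have hle := Nat.gcd_le_left (2 * p) hpos
  have hdvd := Nat.gcd_dvd_right t.val (2 * p)
  generalize Nat.gcd t.val (2 * p) = g at hg hle hdvd
  have multiple : ∀ m, g ∣ m → ((m : ℕ) : ZMod (2 * p)) ∈ P := by
    rintro _ ⟨c, rfl⟩
    rw [mul_comm g, Nat.cast_mul, ← nsmul_eq_mul]
    exact P.nsmul_mem hg c
  by_cases hpg : p ∣ g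
  · obtain ⟨d, rfl⟩ := hpg
    have hd : d < 2 := by
      by_contra hd
      have := Nat.mul_le_mul_left p (not_lt.1 hd)
      omega
    left
    interval_cases d
    · have := Nat.eq_zero_of_zero_dvd (by simpa using hdvd)
      have := hp.pos
      omega
    · simpa using hg
  · right
    exact multiple 2 (((hp.coprime_iff_not_dvd.2 hpg).symm).dvd_of_dvd_mul_right hdvd)

/-- A criterion for a subgroup of `ZMod (2 * p)` to be the whole group. -/
theorem addSubgroup_eq_top (hp : p.Prime) (h : p = 2 * k + 1) (hk : Odd k)
    {P : AddSubgroup (ZMod (2 * p))} (hP : P ≠ ⊥)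
    (h4 : (p : ZMod (2 * p)) ∈ P → (4 : ZMod (2 * p)) ∈ P)
    (hodd : (2 : ZMod (2 * p)) ∈ P → ∃ z ∈ P, parity p z ≠ 0) : P = ⊤ := by
  have : NeZero (2 * p) := ⟨by omega⟩
  apply addSubgroup_eq_top_of_one_mem
  rcases exists_mem_of_ne_bot hp hP with hm | hm
  · obtain ⟨m, rfl⟩ := hk
    -- With `k = 2m + 1` one has `p = 4m + 3`.
    have e : (1 : ZMod (2 * p)) = (m + 1) • (4 : ZMod (2 * p)) - p := by
      have e' : (p : ZMod (2 * p)) = ((2 * (2 * m + 1) + 1 : ℕ) : ZMod (2 * p)) := by rw [← h]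
      rw [e', nsmul_eq_mul]
      push_cast
      ring
    rw [e]
    exact P.sub_mem (P.nsmul_mem (h4 hm) _) hm
  · obtain ⟨z, hz, hz1⟩ := hodd hm
    rw [Ne, ← ZMod.natCast_zmod_val z, map_natCast, ZMod.natCast_eq_zero_iff] at hz1
    obtain ⟨m, hmz⟩ : Odd z.val := by
      rwa [← Nat.not_even_iff_odd, even_iff_two_dvd]
    have e : (1 : ZMod (2 * p)) = z - m • (2 : ZMod (2 * p)) := by
      rw [← ZMod.natCast_zmod_val z, hmz, nsmul_eq_mul]
      push_cast
      ring
    rw [e]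
    exact P.sub_mem hz (P.nsmul_mem hm _)

theorem parity_jFamily_zero_sub_two (h : p = 2 * k + 1) (hk : 1 ≤ k) :
    parity p (jFamily p k 0 - jFamily p k 2) ≠ 0 := by
  have h2 : residue p 2 ≠ 0 := by
    rw [map_ofNat]
    intro e
    have e' : ((2 : ℕ) : ZMod p) = 0 := e
    rw [ZMod.natCast_eq_zero_iff] at e'
    have := Nat.le_of_dvd (by omega) e'
    omega
  rw [map_sub, parity_jFamily h, parity_jFamily h, if_pos (map_zero _), if_neg h2]
  decide

end JFamily

/-! ### Simplicity of the solution -/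

section Congruence

variable {p k : ℕ} {Y : Type v} {f : ZMod (2 * p) × ZMod (2 * p) → Y}

/-- The kernel of `f` is a congruence of the solution `(A², r)`: it is invariant under all maps
`(c₁, c₂) ↦ (c₁ + t, c₂)` and `(c₁, c₂) ↦ (c₁, c₂ - j_{c₁ - a})`, and equivalent elements act
equivalently. -/
structure SquareCongruence (p k : ℕ) (f : ZMod (2 * p) × ZMod (2 * p) → Y) : Prop where
  shift : ∀ {a b a' b'} (t : ZMod (2 * p)), f (a, b) = f (a', b') → f (a + t, b) = f (a' + t, b')
  sub : ∀ {a b a' b'} (u : ZMod (2 * p)), f (a, b) = f (a', b') →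
    f (a, b - jFamily p k (a - u)) = f (a', b' - jFamily p k (a' - u))
  act : ∀ {a b a' b'} (c d : ZMod (2 * p)), f (a, b) = f (a', b') →
    f (c + b, d - jFamily p k (c + b - a)) = f (c + b', d - jFamily p k (c + b' - a'))

/-- The vertical periods of `f`. -/
def verticalPeriods (f : ZMod (2 * p) × ZMod (2 * p) → Y) : AddSubgroup (ZMod (2 * p)) where
  carrier := {q | ∀ e y, f (e, y) = f (e, y + q)}
  add_mem' := fun {q q'} hq hq' e y => by rw [← add_assoc, ← hq', ← hq]
  zero_mem' := fun e y => by rw [add_zero]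
  neg_mem' := fun {q} hq e y => by rw [hq e (y + -q), neg_add_cancel_right]

namespace SquareCongruence

/-- Iterating `sub` gives every multiple, since the coefficient lives in a finite cyclic group; `-m`
turns subtraction into addition. -/
theorem add_mul (H : SquareCongruence p k f) (h : p = 2 * k + 1) {a b a' b' : ZMod (2 * p)}
    (u m : ZMod (2 * p)) (e : f (a, b) = f (a', b')) :
    f (a, b + m * jFamily p k (a - u)) = f (a', b' + m * jFamily p k (a' - u)) := by
  have : NeZero (2 * p) := ⟨by omega⟩
  have key : ∀ n : ℕ, f (a, b - n * jFamily p k (a - u))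
      = f (a', b' - n * jFamily p k (a' - u)) := by
    intro n
    induction n with
    | zero => simpa using e
    | succ n ih =>
      have := H.sub u ih
      simpa only [Nat.cast_add, Nat.cast_one, _root_.add_mul, one_mul, sub_sub] using this
  have := key (-m).val
  simpa only [ZMod.natCast_zmod_val, neg_mul, sub_neg_eq_add] using this

/-- One coincidence within a column is enough: `shift` carries it to any column, and since `j 1 =
1`, the choice `u = c' - 1` in `add_mul` moves it to any height. -/
theorem mem_verticalPeriods (H : SquareCongruence p k f) (h : p = 2 * k + 1) (hk : 1 ≤ k)
    {c d q : ZMod (2 * p)} (e : f (c, d) = f (c, d + q)) : q ∈ verticalPeriods f := by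
  intro c' y
  have := H.add_mul h (c' - 1) (y - d) (H.shift (c' - c) e)
  rw [add_sub_cancel, sub_sub_cancel, jFamily_one h hk, mul_one, add_sub_cancel] at this
  rw [this]
  congr 2
  ring

/-- Adding `p * j (· - a)` to the second coordinate fixes `(a, b)`, as `j 0` is even, and moves
`(a', b')` by `p`, as `j (a' - a)` is odd. Hence two distinct points of column `a'` are identified.
-/
theorem verticalPeriods_ne_bot_of_residue_ne (H : SquareCongruence p k f) (h : p = 2 * k + 1)
    (hk : 1 ≤ k)
    {a b a' b' : ZMod (2 * p)} (e : f (a, b) = f (a', b')) (ha : residue p (a' - a) ≠ 0) :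
    verticalPeriods f ≠ ⊥ := by
  have hp0 : p ≠ 0 := by omega
  have h1 := H.add_mul h a p e
  rw [sub_self, natCast_mul_eq_zero (jFamily p k 0) (by rw [parity_jFamily h, map_zero, if_pos rfl])
    hp0, add_zero] at h1
  rw [e] at h1
  have hne : (p : ZMod (2 * p)) * jFamily p k (a' - a) ≠ 0 :=
    natCast_mul_ne_zero _ (by rw [parity_jFamily h, if_neg ha]; exact one_ne_zero) hp0
  intro hbot
  have := H.mem_verticalPeriods h hk h1
  rw [hbot, AddSubgroup.mem_bot] at this
  exact hne this

theorem verticalPeriods_ne_bot (H : SquareCongruence p k f) (h : p = 2 * k + 1) (hk : 1 ≤ k)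
    {a b a' b' : ZMod (2 * p)} (e : f (a, b) = f (a', b')) (hne : (a, b) ≠ (a', b')) :
    verticalPeriods f ≠ ⊥ := by
  have column : ∀ {c d d' : ZMod (2 * p)}, f (c, d) = f (c, d') → d' - d ≠ 0 →
      verticalPeriods f ≠ ⊥ := fun {c d d'} e' hd hbot => by
    have hm := H.mem_verticalPeriods h hk (c := c) (d := d) (q := d' - d) (by rwa [add_sub_cancel])
    rw [hbot, AddSubgroup.mem_bot] at hm
    exact hd hm
  by_cases hr : residue p (a' - a) = 0
  swap
  · exact H.verticalPeriods_ne_bot_of_residue_ne h hk e hr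
  rcases (residue_eq_zero_iff h _).1 hr with h0 | h0
  · rw [sub_eq_zero] at h0
    subst h0
    exact column e fun hb => hne (by rw [sub_eq_zero.1 hb])
  obtain rfl : a' = a + p := by rw [← h0, add_sub_cancel]
  have anti : ∀ c, jFamily p k (c - (a + p)) = -jFamily p k (c - a) := fun c => by
    rw [← jFamily_add_self h, ← sub_sub]
    congr 1
    rw [sub_eq_iff_eq_add, add_assoc, natCast_two_mul_self, add_zero]
  -- The images of `(0, 0)` under the two actions have first coordinates `b` and `b'`, which brings
  -- back the previous lemma.
  by_cases hs : residue p (b' - b) = 0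
  swap
  · exact H.verticalPeriods_ne_bot_of_residue_ne h hk (H.act 0 0 e)
      (by rwa [zero_add, zero_add])
  rcases (residue_eq_zero_iff h _).1 hs with h1 | h1
  · rw [sub_eq_zero] at h1
    subst h1
    -- This choice evaluates `j` at `1` and `1 - p`, with values `1` and `-1`: a coincidence in one
    -- column at distance `2`.
    have := H.act (a + 1 - b') 0 e
    rw [anti, sub_add_cancel, add_sub_cancel_left, jFamily_one h hk] at this
    refine column this ?_
    have e2 : (0 - -1 - (0 - 1) : ZMod (2 * p)) = 2 := by ring
    rw [e2]
    exact two_ne_zero_zmod h hk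
  · obtain rfl : b' = b + p := by rw [← h1, add_sub_cancel]
    -- Both arguments of `j` are now `0`, so `(a, b)` is identified with `(a + p, b)` as well as
    -- with `(a + p, b + p)`.
    have := H.act (a - b) (b + jFamily p k 0) e
    rw [sub_add_cancel, ← add_assoc, sub_add_cancel, sub_self, sub_self, add_sub_cancel_right,
      e] at this
    refine column this ?_
    rw [sub_add_cancel_left, neg_ne_zero, ← mul_one (p : ZMod (2 * p))]
    exact natCast_mul_ne_zero _ (by rw [map_one]; exact one_ne_zero) (by omega)

/-- The points `(0, 0)` and `(0, q)` are identified, so they act equivalently on `(c, y + j c)`;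
then shift by `-c`. The left side does not involve `c`, so comparing two values of `c` yields new
periods. -/
theorem apply_zero_eq (H : SquareCongruence p k f) {q : ZMod (2 * p)} (hq : q ∈ verticalPeriods f)
    (c y : ZMod (2 * p)) :
    f (0, y) = f (q, y + (jFamily p k c - jFamily p k (c + q))) := by
  have e := hq 0 0
  rw [zero_add] at e
  have e' := H.shift (-c) (H.act c (y + jFamily p k c) e)
  rw [add_zero, sub_zero, sub_zero, add_sub_cancel_right, add_neg_cancel, add_neg_cancel_comm,
    add_sub_assoc] at e'
  exact e'

theorem sub_mem_verticalPeriods (H : SquareCongruence p k f) (h : p = 2 * k + 1) (hk : 1 ≤ k)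
    {q : ZMod (2 * p)} (hq : q ∈ verticalPeriods f) (c d : ZMod (2 * p)) :
    (jFamily p k c - jFamily p k (c + q)) - (jFamily p k d - jFamily p k (d + q))
      ∈ verticalPeriods f := by
  refine H.mem_verticalPeriods h hk (c := q) (d := jFamily p k d - jFamily p k (d + q)) ?_
  have h1 := H.apply_zero_eq hq c 0
  have h2 := H.apply_zero_eq hq d 0
  rw [zero_add] at h1 h2
  rw [add_sub_cancel, ← h1, ← h2]

theorem verticalPeriods_eq_top (H : SquareCongruence p k f) (hp : p.Prime) (h : p = 2 * k + 1)
    (hk : Odd k) (hne : verticalPeriods f ≠ ⊥) : verticalPeriods f = ⊤ := by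
  have hk1 : 1 ≤ k := hk.pos
  refine addSubgroup_eq_top hp h hk hne (fun hm => ?_) fun hm => ?_
  -- The resulting period is `(1 + 1) - (-1 - 1) = 4`.
  · have := H.sub_mem_verticalPeriods h hk1 hm 1 (1 + p)
    rw [jFamily_add_self h (1 + p), jFamily_add_self h, jFamily_one h hk1] at this
    convert this using 1
    ring
  -- Since `j (-1) = j 1`, the second bracket vanishes and the odd period `j 0 - j 2` remains.
  · have := H.sub_mem_verticalPeriods h hk1 hm 0 (-1)
    have e : (-1 + 2 : ZMod (2 * p)) = 1 := by ring
    rw [e, jFamily_neg h, sub_self, sub_zero, zero_add] at this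
    exact ⟨_, this, parity_jFamily_zero_sub_two h hk1⟩

/-- A congruence is trivial: `f` is injective or constant. -/
theorem injective_or_forall_eq (H : SquareCongruence p k f) (hp : p.Prime) (h : p = 2 * k + 1)
    (hk : Odd k) : Function.Injective f ∨ ∀ x y, f x = f y := by
  by_cases hf : Function.Injective f
  · exact Or.inl hf
  right
  simp only [Function.Injective, not_forall] at hf
  obtain ⟨⟨a, b⟩, ⟨a', b'⟩, e, hne⟩ := hf
  have htop := H.verticalPeriods_eq_top hp h hk (H.verticalPeriods_ne_bot h hk.pos e hne)
  have mem : ∀ q, q ∈ verticalPeriods f := fun q => by rw [htop]; trivial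
  have const : ∀ x, f x = f (0, 0) := by
    rintro ⟨c, d⟩
    have h1 := mem (d - (0 + (jFamily p k 0 - jFamily p k (0 + c)))) c
      (0 + (jFamily p k 0 - jFamily p k (0 + c)))
    rw [add_sub_cancel] at h1
    rw [← h1, ← H.apply_zero_eq (mem c)]
  exact fun x y => (const x).trans (const y).symm

end SquareCongruence

end Congruence

/-- The permutation group of the solution preserves the kernel of a homomorphism. -/
theorem YBESolution.IsHom.apply_eq_iff {X : Type u} {Y : Type v} {S : YBESolution X}
    {T : YBESolution Y} {f : X → Y} (hf : S.IsHom T f) {g : Equiv.Perm X}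
    (hg : g ∈ S.permutationGroup) : ∀ x x', f (g x) = f (g x') ↔ f x = f x' := by
  induction hg using Subgroup.closure_induction with
  | mem g hg =>
    obtain ⟨y, rfl⟩ := hg
    intro x x'
    rw [(hf y x).1, (hf y x').1]
    exact (T.σ (f y)).injective.eq_iff
  | one => exact fun _ _ => Iff.rfl
  | mul g g' _ _ hg hg' => exact fun x x' => (hg _ _).trans (hg' _ _)
  | inv g _ hg =>
    intro x x'
    have e := hg (g.symm x) (g.symm x')
    rw [g.apply_symm_apply, g.apply_symm_apply] at e
    exact e.symm

theorem exampleSolution_σ {p k : ℕ} (h : p = 2 * k + 1) (a : ZMod (2 * p) × ZMod (2 * p)) :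
    (exampleSolution h).σ a = squareSigma (jFamily p k) a :=
  Equiv.ext fun _ => rfl

theorem squareSigma_mem {p k : ℕ} (h : p = 2 * k + 1) (a : ZMod (2 * p) × ZMod (2 * p)) :
    squareSigma (jFamily p k) a ∈ (exampleSolution h).permutationGroup :=
  Subgroup.subset_closure ⟨a, exampleSolution_σ h a⟩

/-- The permutation `(c₁, c₂) ↦ (c₁ + t, c₂ - v_{c₁ + t})`. -/
def shear {A : Type u} [AddCommGroup A] (v : A → A) (t : A) : Equiv.Perm (A × A) where
  toFun c := (c.1 + t, c.2 - v (c.1 + t))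
  invFun c := (c.1 - t, c.2 + v c.1)
  left_inv c := by simp
  right_inv c := by simp

/-! ### The group of shears, containing the permutation group -/

section Shear

variable {A : Type u} [AddCommGroup A]

theorem shear_apply (v : A → A) (t : A) (c : A × A) :
    shear v t c = (c.1 + t, c.2 - v (c.1 + t)) := rfl

theorem shear_mul (v w : A → A) (t s : A) :
    shear v t * shear w s = shear (fun d => v d + w (d - t)) (t + s) := by
  refine Equiv.ext fun c => ?_
  simp only [Equiv.Perm.mul_apply, shear_apply]
  have e1 : c.1 + (t + s) = c.1 + s + t := by abel
  rw [e1, add_sub_cancel_right, sub_sub, add_comm (w _)]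

theorem shear_zero : shear (0 : A → A) 0 = 1 :=
  Equiv.ext fun c => by simp [shear_apply]

theorem shear_inv (v : A → A) (t : A) : (shear v t)⁻¹ = shear (fun d => -v (d + t)) (-t) := by
  rw [inv_eq_iff_mul_eq_one, shear_mul, ← shear_zero, add_neg_cancel]
  congr 1
  funext d
  simp

theorem squareSigma_eq_shear (j : A → A) (a : A × A) :
    squareSigma j a = shear (fun d => j (d - a.1)) a.2 := rfl

theorem shear_injective {v w : A → A} {t s : A} (h : shear v t = shear w s) : v = w ∧ t = s := by
  have key := fun c => Equiv.congr_fun h c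
  simp only [shear_apply, Prod.mk.injEq] at key
  obtain rfl : t = s := by simpa using (key (0, 0)).1
  exact ⟨funext fun d => by simpa using (key (d - t, 0)).2, rfl⟩

end Shear

theorem shear_zero_mem {p k : ℕ} (h : p = 2 * k + 1) (t : ZMod (2 * p)) :
    shear 0 t ∈ (exampleSolution h).permutationGroup := by
  -- Both generators have the same vertical part `j`, which cancels in the quotient.
  have := mul_mem (inv_mem (squareSigma_mem h (0, 0))) (squareSigma_mem h (0, t))
  rw [squareSigma_eq_shear, squareSigma_eq_shear, shear_inv, shear_mul] at this
  convert this using 2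
  · funext d
    simp
  · simp

theorem squareCongruence_of_isHom {p k : ℕ} (h : p = 2 * k + 1) {Y : Type v} {T : YBESolution Y}
    {f : ZMod (2 * p) × ZMod (2 * p) → Y} (hf : (exampleSolution h).IsHom T f) :
    SquareCongruence p k f where
  shift {a b a' b'} t e := by
    have := (hf.apply_eq_iff (shear_zero_mem h t) (a, b) (a', b')).2 e
    simpa [shear_apply] using this
  sub {a b a' b'} u e := by
    have := (hf.apply_eq_iff (squareSigma_mem h (u, 0)) (a, b) (a', b')).2 e
    simpa [squareSigma_apply] using this
  act {a b a' b'} c d e := by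
    -- The action of `f (a, b)` on the target depends only on that value.
    have h1 := (hf (a, b) (c, d)).1
    have h2 := (hf (a', b') (c, d)).1
    rw [e, ← h2] at h1
    exact h1

theorem exampleSolution_isSimple {p k : ℕ} (hp : p.Prime) (h : p = 2 * k + 1) (hk : Odd k) :
    (exampleSolution h).IsSimple := by
  have h1 : Fact (1 < 2 * p) := ⟨by omega⟩
  refine ⟨inferInstance, fun Y T f hf hsurj => ?_⟩
  rcases (squareCongruence_of_isHom h hf).injective_or_forall_eq hp h hk with hi | hc
  · exact Or.inl ⟨hi, hsurj⟩
  · right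
    rw [Nat.card_eq_one_iff_unique]
    exact ⟨⟨fun y z => by
      obtain ⟨x, rfl⟩ := hsurj y
      obtain ⟨x', rfl⟩ := hsurj z
      exact hc x x'⟩, T.nonempty⟩

/-! ### Ideals of left braces -/

namespace LeftBrace

variable {B : Type u} [LeftBrace B]

theorem zero_eq_one : (0 : B) = 1 := by
  have h := brace_identity (1 : B) 0 0
  rw [one_mul, one_mul, add_zero] at h
  rw [zero_add] at h
  exact h.symm

theorem add_eq_mul_lam (a b : B) : a + b = a * lam a⁻¹ b := by
  have h1 := brace_identity a (a⁻¹) (-a⁻¹)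
  rw [add_neg_cancel, zero_eq_one, mul_one, mul_inv_cancel, ← zero_eq_one, zero_add] at h1
  have h2 := brace_identity a (-a⁻¹) (a⁻¹ * b)
  rw [← h1, mul_inv_cancel_left, add_assoc a a b, add_comm a (a + b)] at h2
  exact (add_right_cancel h2).symm

theorem IsIdeal.neg_mem {I : Subgroup B} (hI : IsIdeal I) {g : B} (hg : g ∈ I) : -g ∈ I := by
  -- Because `g * g⁻¹ = 1 = 0`, one has `lam g g⁻¹ = -g`.
  have h := hI.2 g g⁻¹ (I.inv_mem hg)
  rwa [lam, mul_inv_cancel, ← zero_eq_one, add_zero] at h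

/-- Elements of an ideal `I` act trivially, by the lambda map, modulo `I`. -/
theorem IsIdeal.inv_mul_lam_mem {I : Subgroup B} (hI : IsIdeal I) {g : B} (hg : g ∈ I) (b : B) :
    b⁻¹ * lam g b ∈ I := by
  -- Writing `-g + g * b` as `g * b * lam (g * b)⁻¹ (-g)` splits the element into a conjugate of `g`
  -- and a lambda image of `-g`.
  have h1 := hI.1.conj_mem g hg b⁻¹
  have h2 := I.mul_mem h1 (hI.2 (g * b)⁻¹ (-g) (hI.neg_mem hg))
  rw [lam, add_comm, add_eq_mul_lam]
  simpa [mul_assoc] using h2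

end LeftBrace

/-! ### Simplicity of the left brace -/

section Ideal

variable {p k : ℕ}

theorem exists_eq_shear (h : p = 2 * k + 1) {g : Equiv.Perm (ZMod (2 * p) × ZMod (2 * p))}
    (hg : g ∈ (exampleSolution h).permutationGroup) : ∃ v t, g = shear v t := by
  induction hg using Subgroup.closure_induction with
  | mem g hg =>
    obtain ⟨a, rfl⟩ := hg
    exact ⟨_, _, (exampleSolution_σ h a).trans (squareSigma_eq_shear _ _)⟩
  | one => exact ⟨_, _, shear_zero.symm⟩
  | mul g g' _ _ hg hg' =>
    obtain ⟨v, t, rfl⟩ := hg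
    obtain ⟨w, s, rfl⟩ := hg'
    exact ⟨_, _, shear_mul _ _ _ _⟩
  | inv g _ hg =>
    obtain ⟨v, t, rfl⟩ := hg
    exact ⟨_, _, shear_inv _ _⟩

/-- A normal subgroup `J` of the permutation group whose elements act trivially, by the lambda map,
modulo `J`. -/
structure SquareIdeal (h : p = 2 * k + 1)
    (J : Subgroup (Equiv.Perm (ZMod (2 * p) × ZMod (2 * p)))) : Prop where
  le : J ≤ (exampleSolution h).permutationGroup
  conj_mem : ∀ g ∈ (exampleSolution h).permutationGroup, ∀ x ∈ J, g * x * g⁻¹ ∈ J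
  lam_mem : ∀ x ∈ J, ∀ y, (squareSigma (jFamily p k) y)⁻¹ * squareSigma (jFamily p k) (x y) ∈ J

variable {h : p = 2 * k + 1} {J : Subgroup (Equiv.Perm (ZMod (2 * p) × ZMod (2 * p)))}

/-- The translations of the first coordinate that lie in `J`. -/
def horizontalShifts (J : Subgroup (Equiv.Perm (ZMod (2 * p) × ZMod (2 * p)))) :
    AddSubgroup (ZMod (2 * p)) where
  carrier := {t | shear 0 t ∈ J}
  add_mem' := fun {s t} hs ht => by
    have := J.mul_mem hs ht
    rw [shear_mul] at this
    simpa [Pi.zero_def] using this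
  zero_mem' := by
    change shear 0 0 ∈ J
    rw [shear_zero]
    exact J.one_mem
  neg_mem' := fun {t} ht => by
    have := J.inv_mem ht
    rw [shear_inv] at this
    simpa [Pi.zero_def] using this

/-- The functions `v` for which `(c₁, c₂) ↦ (c₁, c₂ - v_{c₁})` lies in `J`. -/
def verticalShears (J : Subgroup (Equiv.Perm (ZMod (2 * p) × ZMod (2 * p)))) :
    AddSubgroup (ZMod (2 * p) → ZMod (2 * p)) where
  carrier := {v | shear v 0 ∈ J}
  add_mem' := fun {v w} hv hw => by
    have := J.mul_mem hv hw
    rw [shear_mul, add_zero] at this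
    simp only [sub_zero] at this
    exact this
  zero_mem' := by
    change shear 0 0 ∈ J
    rw [shear_zero]
    exact J.one_mem
  neg_mem' := fun {v} hv => by
    have := J.inv_mem hv
    rw [shear_inv, neg_zero] at this
    simp only [add_zero] at this
    exact this

namespace SquareIdeal

/-- This shear is the commutator of `σ (a, 0)` with `shear v t`; the part `v` cancels because
vertical shears commute. -/
theorem sub_mem_verticalShears (H : SquareIdeal h J) {v : ZMod (2 * p) → ZMod (2 * p)}
    {t : ZMod (2 * p)} (hg : shear v t ∈ J) (a : ZMod (2 * p)) :
    (fun d => jFamily p k (d - a) - jFamily p k (d - t - a)) ∈ verticalShears J := by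
  have := J.mul_mem (H.conj_mem _ (squareSigma_mem h (a, 0)) _ hg) (J.inv_mem hg)
  rw [squareSigma_eq_shear, shear_inv, shear_inv, shear_mul, shear_mul, shear_mul] at this
  change shear _ _ ∈ J
  convert this using 2
  · funext d
    simp
    ring
  · simp

/-- The shear sends `(a, 0)` to `(a, -v a)`. The generators at these two points have the same
vertical part, so their quotient is the horizontal translation by `-v a`. -/
theorem apply_mem_horizontalShifts (H : SquareIdeal h J) {v : ZMod (2 * p) → ZMod (2 * p)}
    (hv : v ∈ verticalShears J) (a : ZMod (2 * p)) : v a ∈ horizontalShifts J := by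
  rw [← neg_mem_iff]
  have := H.lam_mem _ hv (a, 0)
  rw [shear_apply, squareSigma_eq_shear, squareSigma_eq_shear, shear_inv, shear_mul] at this
  change shear _ _ ∈ J
  convert this using 2
  · funext d
    simp
  · simp

theorem sub_mem_horizontalShifts (H : SquareIdeal h J) {v : ZMod (2 * p) → ZMod (2 * p)}
    {t : ZMod (2 * p)} (hg : shear v t ∈ J) (c : ZMod (2 * p)) :
    jFamily p k c - jFamily p k (c - t) ∈ horizontalShifts J := by
  simpa using H.apply_mem_horizontalShifts (H.sub_mem_verticalShears hg 0) c

/-- If no nonzero translation lay in `J`, then `j` would have period `t` for each `shear v t` in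
`J`. Parity forces `t` to be `0` or `p`; antiperiodicity with `j 1 = 1` excludes `p`, and for `t =
0` every value of `v` vanishes. -/
theorem horizontalShifts_ne_bot (H : SquareIdeal h J) (hk : 1 ≤ k) (hJ : J ≠ ⊥) :
    horizontalShifts J ≠ ⊥ := by
  obtain ⟨g, hg, hg1⟩ := J.bot_or_exists_ne_one.resolve_left hJ
  obtain ⟨v, t, rfl⟩ := exists_eq_shear h (H.le hg)
  intro hbot
  have zero : ∀ {q}, q ∈ horizontalShifts J → q = 0 := fun hq => by
    rwa [hbot, AddSubgroup.mem_bot] at hq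
  have period : ∀ c, jFamily p k c = jFamily p k (c - t) := fun c =>
    sub_eq_zero.1 (zero (H.sub_mem_horizontalShifts hg c))
  have hr : residue p t = 0 := by
    by_contra hr
    have := congrArg (parity p) (period t)
    rw [sub_self, parity_jFamily h, parity_jFamily h, if_neg hr, if_pos (map_zero _)] at this
    exact one_ne_zero this
  rcases (residue_eq_zero_iff h t).1 hr with rfl | rfl
  · refine hg1 ?_
    rw [← shear_zero]
    congr 1
    exact funext fun a => zero (H.apply_mem_horizontalShifts (v := v) hg a)
  · have h1 := jFamily_add_self h (1 - p)
    rw [sub_add_cancel, ← period, jFamily_one h hk] at h1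
    refine two_ne_zero_zmod h hk ?_
    linear_combination h1

theorem horizontalShifts_eq_top (H : SquareIdeal h J) (hp : p.Prime) (hk : Odd k) (hJ : J ≠ ⊥) :
    horizontalShifts J = ⊤ := by
  refine addSubgroup_eq_top hp h hk (H.horizontalShifts_ne_bot hk.pos hJ) (fun hm => ?_)
    fun hm => ?_
  -- This gives `j (1 + p) - j 1 = -2`, whose double is `-4`.
  · have h1 := H.sub_mem_horizontalShifts hm (1 + p)
    rw [add_sub_cancel_right, jFamily_add_self h, jFamily_one h hk.pos] at h1
    convert neg_mem (add_mem h1 h1) using 1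
    ring
  · have h1 := H.sub_mem_horizontalShifts hm 2
    rw [sub_self] at h1
    exact ⟨_, neg_mem h1, by rw [neg_sub]; exact parity_jFamily_zero_sub_two h hk.pos⟩

/-- Let `w t` be the shear `j (· - a) - j (· - t - a)` in `J`. Summing over `t < p` and multiplying
by `p` gives `p ^ 2` times `j (· - a)`, since a sum of `p` consecutive values of `j` is even. As `w
p` is `2 * j (· - a)` and `p` is odd, `j (· - a)` is a combination. -/
theorem jFamily_mem_verticalShears (H : SquareIdeal h J) (hP : horizontalShifts J = ⊤)
    (a : ZMod (2 * p)) : (fun d => jFamily p k (d - a)) ∈ verticalShears J := by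
  have mem : ∀ t, (fun d => jFamily p k (d - a) - jFamily p k (d - t - a)) ∈ verticalShears J :=
    fun t => H.sub_mem_verticalShears (v := 0) (t := t)
      (show t ∈ horizontalShifts J by rw [hP]; trivial) a
  have h1 := sum_mem (t := Finset.range p) fun n _ => mem (n : ZMod (2 * p))
  -- The coefficient comes from `p ^ 2 - 2 * (2 * k ^ 2 + 2 * k) = 1`.
  have h2 := (verticalShears J).sub_mem ((verticalShears J).nsmul_mem h1 p)
    ((verticalShears J).nsmul_mem (mem p) (2 * k ^ 2 + 2 * k))
  convert h2 using 1
  funext d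
  have h3 : (p : ZMod (2 * p)) * ∑ n ∈ Finset.range p, jFamily p k (d - a - n) = 0 :=
    natCast_mul_eq_zero _ (parity_sum_jFamily h _) (by omega)
  have h4 : jFamily p k (d - p - a) = -jFamily p k (d - a) := by
    have := jFamily_add_self h (d - p - a)
    rw [show d - p - a + p = d - a by ring] at this
    rw [this, neg_neg]
  have h5 : ∀ n : ZMod (2 * p), d - n - a = d - a - n := fun n => by ring
  have hpc : (p : ZMod (2 * p)) = 2 * k + 1 := by
    have := congrArg (Nat.cast : ℕ → ZMod (2 * p)) h
    push_cast at this
    exact this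
  rw [Pi.sub_apply, Pi.smul_apply, Pi.smul_apply, Finset.sum_apply, Finset.sum_sub_distrib, h4]
  simp only [h5, Finset.sum_const, Finset.card_range, nsmul_eq_mul, mul_sub, h3, sub_zero]
  rw [hpc]
  push_cast
  ring

theorem permutationGroup_le (H : SquareIdeal h J) (hp : p.Prime) (hk : Odd k) (hJ : J ≠ ⊥) :
    (exampleSolution h).permutationGroup ≤ J := by
  have hP := H.horizontalShifts_eq_top hp hk hJ
  refine (Subgroup.closure_le _).2 ?_
  rintro _ ⟨⟨a, t⟩, rfl⟩
  have h1 : shear 0 t ∈ J := show t ∈ horizontalShifts J by rw [hP]; trivial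
  have h2 := J.mul_mem (H.jFamily_mem_verticalShears hP a) h1
  rw [shear_mul] at h2
  rw [exampleSolution_σ, squareSigma_eq_shear]
  simpa using h2

end SquareIdeal

theorem LeftBrace.IsIdeal.squareIdeal {I : Subgroup (exampleSolution h).permutationGroup}
    (hI : LeftBrace.IsIdeal I) :
    SquareIdeal h (I.map (exampleSolution h).permutationGroup.subtype) where
  le := Subgroup.map_subtype_le I
  conj_mem := by
    rintro g hg _ ⟨x, hx, rfl⟩
    exact ⟨_, hI.1.conj_mem x hx ⟨g, hg⟩, rfl⟩
  lam_mem := by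
    rintro _ ⟨x, hx, rfl⟩ y
    have := hI.inv_mul_lam_mem hx ((exampleSolution h).σ' y)
    rw [YBESolution.lam_σ'] at this
    refine ⟨_, this, ?_⟩
    rw [← exampleSolution_σ h, ← exampleSolution_σ h]
    rfl

theorem permutationGroup_isSimple (hp : p.Prime) (h : p = 2 * k + 1) (hk : Odd k) :
    LeftBrace.IsSimple (exampleSolution h).permutationGroup := by
  have h1 : Fact (1 < 2 * p) := ⟨by omega⟩
  refine ⟨⟨⟨_, shear_zero_mem h 1⟩, 1, fun e => ?_⟩, fun I hI => ?_⟩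
  · have e' : shear (0 : ZMod (2 * p) → ZMod (2 * p)) 1 = shear 0 0 := by
      rw [shear_zero]
      exact congrArg Subtype.val e
    exact one_ne_zero (shear_injective e').2
  · by_cases hbot : I.map (exampleSolution h).permutationGroup.subtype = ⊥
    · left
      exact (Subgroup.map_eq_bot_iff_of_injective _ (Subgroup.subtype_injective _)).1 hbot
    · right
      rw [eq_top_iff]
      rintro ⟨g, hg⟩ -
      obtain ⟨x, hx, rfl⟩ := hI.squareIdeal.permutationGroup_le hp hk hbot hg
      exact hx

end Ideal

theorem proposition4p3 (p k : ℕ) (hp : p.Prime) (hpk : p = 2 * k + 1) (hk : Odd k) :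
    (exampleSolution hpk).IsSimple ∧
      Nat.card (ZMod (2 * p) × ZMod (2 * p)) = 4 * p ^ 2 ∧
      LeftBrace.IsSimple (exampleSolution hpk).permutationGroup := by
  refine ⟨exampleSolution_isSimple hp hpk hk, ?_, permutationGroup_isSimple hp hpk hk⟩
  rw [Nat.card_prod, Nat.card_zmod]
  ring
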